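/- Let $G=(V,E)$ be a finite connected simple graph with $|V|\ge 2$. For $N\ge 1$ let $G^N$ be the $N$-fold Cartesian power of $G$: its vertex set is $V^N$, and $x,y\in V^N$ are adjacent if and only if, for some $i$, $x_i$ and $y_i$ are adjacent in $G$ and $x_j=y_j$ for all $j\ne i$. For $k\ge 1$ let $G^{[N,k]}$ be the distance $k$-graph of $G^N$, that is, the graph on $V^N$ in which $x$ and $y$ are adjacent if and only if their graph distance in $G^N$ equals $k$, and let $A^{[N,k]}$ be its adjacency matrix. For a real symmetric matrix $M$ of size $n$ with eigenvalues $\lambda_1,\dots,\lambda_n$ (counted with multiplicity), the eigenvalue distribution of $M$ is the probability measure $\frac1n\sum_{i=1}^n\delta_{\lambda_i}$ on $\mathbb R$. Then, for every fixed $k\ge 1$, the eigenvalue distribution $\mu_N$ of $N^{-k/2}A^{[N,k]}$ converges in moments, as $N\to\infty$, to the distribution $\nu$ of the random variable $$\left(\frac{2|E|}{|V|}\right)^{k/2}\frac{1}{k!}\,\tilde H_k(g),$$ where $g$ is a standard normal $N(0,1)$ random variable and $\tilde H_k$ is the monic (probabilists') Hermite polynomial of degree $k$, given by $\tilde H_0(x)=1$,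 $\tilde H_1(x)=x$ and $x\tilde H_n(x)=\tilde H_{n+1}(x)+n\tilde H_{n-1}(x)$ for $n\ge1$. That is, all moments of $\mu_N$ and of $\nu$ exist, and $\lim_{N\to\infty}\int x^m\,d\mu_N(x)=\int x^m\,d\nu(x)$ for every integer $m\ge 0$. -/

import Mathlib

open MeasureTheory ProbabilityTheory Filter Topology
open scoped ENNReal

/-- The `N`-fold Cartesian power of a graph: two `N`-tuples of vertices are adjacent when they
are adjacent in exactly one coordinate and agree in all the others. -/
def SimpleGraph.cartesianPower {V : Type*} (G : SimpleGraph V) (N : ℕ) :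
    SimpleGraph (Fin N → V) where
  Adj x y := ∃ i, G.Adj (x i) (y i) ∧ ∀ j, j ≠ i → x j = y j
  symm := ⟨fun _ _ ⟨i, hi, h⟩ => ⟨i, hi.symm, fun j hj => (h j hj).symm⟩⟩
  loopless := ⟨fun _ ⟨_, hi, _⟩ => hi.ne rfl⟩

/-- The distance `k`-graph of `G`: same vertices, and two distinct vertices are adjacent when
their graph distance in `G` (infinite if they are not connected by a walk) is exactly `k`. -/
def SimpleGraph.distanceGraph {V : Type*} (G : SimpleGraph V) (k : ℕ) : SimpleGraph V where
  Adj x y := x ≠ y ∧ G.edist x y = k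
  symm := ⟨fun _ _ ⟨hne, h⟩ => ⟨hne.symm, SimpleGraph.edist_comm.trans h⟩⟩
  loopless := ⟨fun _ h => h.1 rfl⟩

noncomputable instance SimpleGraph.distanceGraph.instDecidableRel {V : Type*}
    (G : SimpleGraph V) (k : ℕ) : DecidableRel (G.distanceGraph k).Adj :=
  Classical.decRel _

/-- The adjacency matrix of the distance `k`-graph of the `N`-fold Cartesian power of `G`. -/
noncomputable def SimpleGraph.powerDistanceMatrix {V : Type*} (G : SimpleGraph V) (N k : ℕ) :
    Matrix (Fin N → V) (Fin N → V) ℝ :=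
  ((G.cartesianPower N).distanceGraph k).adjMatrix ℝ

theorem SimpleGraph.isHermitian_smul_powerDistanceMatrix {V : Type*} (G : SimpleGraph V)
    (N k : ℕ) (c : ℝ) : (c • G.powerDistanceMatrix N k).IsHermitian := by
  rw [Matrix.IsHermitian, Matrix.conjTranspose_eq_transpose_of_trivial, Matrix.transpose_smul,
    SimpleGraph.powerDistanceMatrix, SimpleGraph.transpose_adjMatrix]

/-- The eigenvalue distribution of a real symmetric matrix: the probability measure giving each
eigenvalue, counted with multiplicity, the mass `1 / (size of the matrix)`. -/
noncomputable def Matrix.IsHermitian.eigenvalueDistribution {n : Type*} [Fintype n]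
    [DecidableEq n] {A : Matrix n n ℝ} (hA : A.IsHermitian) : Measure ℝ :=
  (Fintype.card n : ℝ≥0∞)⁻¹ • ∑ i, Measure.dirac (hA.eigenvalues i)

/-- Convergence in moments: all moments of all the measures exist, and for each `m` the `m`-th
moments of `μ N` converge to the `m`-th moment of `ν`. -/
def ConvergesInMoments (μ : ℕ → Measure ℝ) (ν : Measure ℝ) : Prop :=
  (∀ N m : ℕ, Integrable (fun x : ℝ => x ^ m) (μ N)) ∧
  (∀ m : ℕ, Integrable (fun x : ℝ => x ^ m) ν) ∧
  ∀ m : ℕ, Tendsto (fun N => ∫ x, x ^ m ∂(μ N)) atTop (𝓝 (∫ x, x ^ m ∂ν))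

/-! The proof is the method of moments with one formal variable per matrix factor. Distances in
`G^N` add over coordinates, so the matrices with entries `X_j ^ dist(x, y)` tensorize, and the trace
of their product over `j < m` is the `N`-th power of the same trace for `G`
(`trace_kernelProd_sum`). The trace of the `m`-th power of the distance matrix is its coefficient at
`∏ X_j ^ k` (`trace_pow_eq_coeff`).

Divided by `|V|`, the one-coordinate trace is `1 + α e₂` up to terms of order three, with `e₂ =
∑_{i<j} X_i X_j` and `α = 2|E|/|V|`: adjacency matrices have trace zero, and the square of that of
`G` has trace `2|E|` (`trace_kernelProd_sub_mem`). Replacing `X_j` by `X_j / √N` and raising to the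
power `N` gives `exp (α e₂)` coefficientwise (`tendsto_coeff_pow`).

Finally `exp e₂` is the generating function of the Gaussian integrals of `∏ H_{s_j} / s_j!`: both
satisfy the same recursion, one by Gaussian integration by parts, the other by differentiating the
exponential (`hermiteIntegral_eq`). -/

namespace SimpleGraph

/-! ### Additivity of the distance in Cartesian powers. -/

variable {V : Type*} {G : SimpleGraph V} {N : ℕ}

/-- One step of a walk moves one coordinate along one edge, so it changes the sum of distances by at
most one. -/
theorem Connected.sum_dist_le_length (hG : G.Connected) {x y : Fin N → V}
    (p : (G.cartesianPower N).Walk x y) : ∑ i, G.dist (x i) (y i) ≤ p.length := by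
  induction p with
  | nil => simp
  | @cons x y z h p ih =>
    rw [Walk.length_cons]
    obtain ⟨i, hi, hj⟩ := h
    calc ∑ l, G.dist (x l) (z l)
        ≤ ∑ l, (G.dist (y l) (z l) + if l = i then 1 else 0) := by
          refine Finset.sum_le_sum fun l _ => ?_
          split_ifs with hl
          · subst hl
            have := hG.dist_triangle (u := x l) (v := y l) (w := z l)
            rw [dist_eq_one_iff_adj.mpr hi] at this
            omega
          · rw [hj l hl, add_zero]
      _ = ∑ l, G.dist (y l) (z l) + 1 := by simp [Finset.sum_add_distrib]
      _ ≤ p.length + 1 := by omega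

theorem Connected.exists_adj_dist_eq_add_one (hG : G.Connected) {u v : V}
    (h : G.dist u v ≠ 0) : ∃ z, G.Adj u z ∧ G.dist u v = G.dist z v + 1 := by
  obtain ⟨p, hp⟩ := hG.exists_walk_length_eq_dist u v
  cases p with
  | nil => simp at h
  | @cons _ z _ hadj q =>
    refine ⟨z, hadj, ?_⟩
    have h1 := G.dist_le q
    have h2 := hG.dist_triangle (u := u) (v := z) (w := v)
    rw [dist_eq_one_iff_adj.mpr hadj] at h2
    rw [Walk.length_cons] at hp
    omega

/-- As long as some coordinate differs, it can be moved one edge along a geodesic, which lowers the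
sum by exactly one. -/
theorem Connected.exists_walk_cartesianPower (hG : G.Connected) (n : ℕ) (x y : Fin N → V)
    (h : ∑ i, G.dist (x i) (y i) = n) :
    ∃ p : (G.cartesianPower N).Walk x y, p.length = n := by
  induction n generalizing x with
  | zero =>
    obtain rfl : x = y := funext fun i => by
      simpa [hG.dist_eq_zero_iff] using (Finset.sum_eq_zero_iff.mp h) i (Finset.mem_univ i)
    exact ⟨Walk.nil, rfl⟩
  | succ n ih =>
    obtain ⟨i, -, hi⟩ : ∃ i ∈ Finset.univ, G.dist (x i) (y i) ≠ 0 := by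
      by_contra! hc
      rw [Finset.sum_eq_zero hc] at h
      omega
    obtain ⟨z, hadj, hz⟩ := hG.exists_adj_dist_eq_add_one hi
    have hsum : ∑ l, G.dist (Function.update x i z l) (y l) = n := by
      rw [← Finset.add_sum_erase _ _ (Finset.mem_univ i)] at h ⊢
      rw [Function.update_self, Finset.sum_congr rfl (g := fun l => G.dist (x l) (y l))]
      · omega
      · intro l hl
        rw [Function.update_of_ne (Finset.ne_of_mem_erase hl)]
    obtain ⟨r, hr⟩ := ih _ hsum
    have hxz : (G.cartesianPower N).Adj x (Function.update x i z) :=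
      ⟨i, by simpa using hadj, fun j hj => by rw [Function.update_of_ne hj]⟩
    exact ⟨Walk.cons hxz r, by rw [Walk.length_cons, hr]⟩

theorem Connected.edist_cartesianPower (hG : G.Connected) (x y : Fin N → V) :
    (G.cartesianPower N).edist x y = (∑ i, G.dist (x i) (y i) : ℕ) := by
  obtain ⟨p, hp⟩ := hG.exists_walk_cartesianPower _ x y rfl
  obtain ⟨q, hq⟩ := p.reachable.exists_walk_length_eq_edist
  refine le_antisymm (hp ▸ edist_le p) ?_
  rw [← hq]
  exact_mod_cast hG.sum_dist_le_length q

theorem Connected.powerDistanceMatrix_eq (hG : G.Connected) {k : ℕ} (hk : 1 ≤ k) :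
    G.powerDistanceMatrix N k =
      Matrix.of fun x y => if ∑ i, G.dist (x i) (y i) = k then (1 : ℝ) else 0 := by
  ext x y
  rw [powerDistanceMatrix, adjMatrix_apply, Matrix.of_apply]
  refine if_congr ?_ rfl rfl
  -- Since `1 ≤ k`, a distance sum equal to `k` already forces `x ≠ y`.
  change (x ≠ y ∧ (G.cartesianPower N).edist x y = k) ↔ _
  rw [hG.edist_cartesianPower, Nat.cast_inj, and_iff_right_iff_imp]
  rintro h rfl
  simp at h
  omega

end SimpleGraph

/-! ### Moments of the eigenvalue distribution as traces. -/

namespace Matrix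

theorem IsHermitian.trace_pow_eq {n : Type*} [Fintype n] [DecidableEq n] {A : Matrix n n ℝ}
    (hA : A.IsHermitian) (m : ℕ) : (A ^ m).trace = ∑ i, hA.eigenvalues i ^ m := by
  conv_lhs => rw [hA.spectral_theorem, ← map_pow, Unitary.conjStarAlgAut_apply, trace_mul_cycle,
    Unitary.coe_star_mul_self, one_mul, diagonal_pow, trace_diagonal]
  simp

theorem IsHermitian.integrable_eigenvalueDistribution {n : Type*} [Fintype n] [DecidableEq n]
    {A : Matrix n n ℝ} [Nonempty n] (hA : A.IsHermitian) (f : ℝ → ℝ) :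
    Integrable f hA.eigenvalueDistribution := by
  refine Integrable.smul_measure ?_ (by simp)
  exact integrable_finsetSum_measure.mpr fun i _ => integrable_dirac (by simp)

theorem IsHermitian.integral_pow_eigenvalueDistribution {n : Type*} [Fintype n] [DecidableEq n]
    {A : Matrix n n ℝ} (hA : A.IsHermitian) (m : ℕ) :
    ∫ x, x ^ m ∂hA.eigenvalueDistribution = (Fintype.card n : ℝ)⁻¹ * (A ^ m).trace := by
  rw [IsHermitian.eigenvalueDistribution, integral_smul_measure,
    integral_finsetSum_measure fun i _ => integrable_dirac (by simp), hA.trace_pow_eq]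
  simp

end Matrix

/-! ### Generating polynomials for traces of powers. -/

/-- The product `K₀ K₁ ⋯ K_{m-1}` of the matrices with entries `K_j(x, y) = X_j ^ δ(x, y)`. -/
noncomputable def kernelProd {W : Type*} [Fintype W] [DecidableEq W] (δ : W → W → ℕ) :
    ℕ → Matrix W W (MvPolynomial ℕ ℝ)
  | 0 => 1
  | m + 1 => kernelProd δ m * Matrix.of fun x y => MvPolynomial.X m ^ δ x y

/-- The exponent of the monomial `X₀ ^ k ⋯ X_{m-1} ^ k`. -/
noncomputable def constExponent (k m : ℕ) : ℕ →₀ ℕ :=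
  ∑ j ∈ Finset.range m, Finsupp.single j k

theorem constExponent_succ (k m : ℕ) :
    constExponent k (m + 1) = constExponent k m + Finsupp.single m k :=
  Finset.sum_range_succ _ _

theorem constExponent_apply (k m j : ℕ) : constExponent k m j = if j < m then k else 0 := by
  simp [constExponent, Finsupp.finsetSum_apply, Finsupp.single_apply]

theorem degree_constExponent (k m : ℕ) : (constExponent k m).degree = m * k := by
  simp [constExponent]

section kernelProd

variable {W : Type*} [Fintype W] [DecidableEq W] (δ : W → W → ℕ)

theorem kernelProd_succ_apply (m : ℕ) (x y : W) : kernelProd δ (m + 1) x y =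
    ∑ z, kernelProd δ m x z * MvPolynomial.monomial (Finsupp.single m (δ z y)) 1 := by
  simp [kernelProd, Matrix.mul_apply, MvPolynomial.X_pow_eq_monomial]

/-- Only the variables `X_0, …, X_{m-1}` occur in the product of the first `m` factors. -/
theorem coeff_kernelProd_eq_zero {m : ℕ} {s : ℕ →₀ ℕ} {j : ℕ} (hj : m ≤ j) (hs : s j ≠ 0)
    (x y : W) : (kernelProd δ m x y).coeff s = 0 := by
  induction m generalizing s y with
  | zero =>
    have : (0 : ℕ →₀ ℕ) ≠ s := by rintro rfl; simp at hs
    rw [kernelProd, Matrix.one_apply]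
    split_ifs <;> simp [MvPolynomial.coeff_one, this]
  | succ m ih =>
    rw [kernelProd_succ_apply, MvPolynomial.coeff_sum]
    refine Finset.sum_eq_zero fun z _ => ?_
    rw [MvPolynomial.coeff_mul_monomial']
    split_ifs with h
    · rw [ih (by omega), zero_mul]
      rwa [Finsupp.tsub_apply, Finsupp.single_eq_of_ne (by omega), tsub_zero]
    · rfl

/-- The entry is a sum over paths `z_0, …, z_m` of `∏ X_j ^ δ(z_j, z_{j+1})`. Each step has its own
variable, so the chosen monomial selects the paths all of whose steps have `δ = k`. -/
theorem coeff_kernelProd_constExponent (k m : ℕ) (x y : W) :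
    (kernelProd δ m x y).coeff (constExponent k m) =
      ((Matrix.of fun x y => if δ x y = k then (1 : ℝ) else 0) ^ m) x y := by
  induction m generalizing y with
  | zero =>
    rw [kernelProd, pow_zero, Matrix.one_apply, Matrix.one_apply]
    split_ifs <;> simp [constExponent]
  | succ m ih =>
    rw [kernelProd_succ_apply, MvPolynomial.coeff_sum, pow_succ, Matrix.mul_apply]
    refine Finset.sum_congr rfl fun z _ => ?_
    rw [MvPolynomial.coeff_mul_monomial', ← ih, Matrix.of_apply, constExponent_succ, mul_one,
      mul_ite, mul_one, mul_zero]
    rcases lt_trichotomy (δ z y) k with h | h | h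
    -- A positive power of `X_m` would have to come from the first `m` factors, which do not contain
    -- that variable.
    · rw [if_neg h.ne, ite_eq_right_iff]
      intro
      refine coeff_kernelProd_eq_zero δ le_rfl ?_ x z
      simp [constExponent_apply]
      omega
    · rw [if_pos h, h, if_pos le_add_self, add_tsub_cancel_right]
    · rw [if_neg h.ne', if_neg]
      simp [Finsupp.single_le_iff, constExponent_apply, h]

/-- Additive exponents make each factor a product over coordinates, and the sum over intermediate
tuples distributes over that product. -/
theorem kernelProd_sum_apply (N m : ℕ) (x y : Fin N → W) :
    kernelProd (fun x y : Fin N → W => ∑ i, δ (x i) (y i)) m x y =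
      ∏ i, kernelProd δ m (x i) (y i) := by
  induction m generalizing y with
  | zero =>
    simp only [kernelProd, Matrix.one_apply, Finset.prod_ite_zero, Finset.prod_const_one,
      Finset.mem_univ, true_imp_iff, funext_iff]
  | succ m ih =>
    simp only [kernelProd, Matrix.mul_apply, ih, Matrix.of_apply, ← Finset.prod_pow_eq_pow_sum,
      ← Finset.prod_mul_distrib]
    rw [Finset.prod_univ_sum, Fintype.piFinset_univ]

theorem trace_kernelProd_sum (N m : ℕ) :
    (kernelProd (fun x y : Fin N → W => ∑ i, δ (x i) (y i)) m).trace =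
      (kernelProd δ m).trace ^ N := by
  simp only [Matrix.trace, Matrix.diag, kernelProd_sum_apply]
  rw [← Fintype.piFinset_univ, ← Finset.prod_univ_sum (fun _ => Finset.univ)
    fun _ x => kernelProd δ m x x, Finset.prod_const, Finset.card_univ, Fintype.card_fin]

theorem trace_pow_eq_coeff (k m N : ℕ) :
    ((Matrix.of fun x y : Fin N → W => if ∑ i, δ (x i) (y i) = k then (1 : ℝ) else 0) ^ m).trace =
      ((kernelProd δ m).trace ^ N).coeff (constExponent k m) := by
  rw [← trace_kernelProd_sum, Matrix.trace, Matrix.trace, MvPolynomial.coeff_sum]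
  exact Finset.sum_congr rfl fun x _ =>
    (coeff_kernelProd_constExponent (fun x y : Fin N → W => ∑ i, δ (x i) (y i)) k m x x).symm

end kernelProd

/-! ### Second-order expansion of the one-coordinate trace. -/

open MvPolynomial

/-- The second elementary symmetric polynomial in the first `m` variables. -/
noncomputable def pairSum (m : ℕ) : MvPolynomial ℕ ℝ :=
  C (1 / 2) * ((∑ i ∈ Finset.range m, X i) ^ 2 - ∑ i ∈ Finset.range m, X i ^ 2)

theorem pairSum_succ (m : ℕ) :
    pairSum (m + 1) = pairSum m + (∑ i ∈ Finset.range m, X i) * X m := by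
  have h : (C (1 / 2) * 2 : MvPolynomial ℕ ℝ) = 1 := by
    rw [← map_ofNat C 2, ← map_mul]; norm_num
  simp only [pairSum, Finset.sum_range_succ]
  linear_combination ((∑ i ∈ Finset.range m, X i) * X m) * h

theorem isHomogeneous_pairSum (m : ℕ) : (pairSum m).IsHomogeneous 2 := by
  have h1 : (∑ i ∈ Finset.range m, X i : MvPolynomial ℕ ℝ).IsHomogeneous 1 :=
    IsHomogeneous.sum _ _ _ fun i _ => isHomogeneous_X _ i
  have h2 : (∑ i ∈ Finset.range m, X i ^ 2 : MvPolynomial ℕ ℝ).IsHomogeneous 2 :=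
    IsHomogeneous.sum _ _ _ fun i _ => isHomogeneous_X_pow i 2
  exact ((h1.pow 2).sub h2).C_mul _

theorem MvPolynomial.IsHomogeneous.mem_pow_idealOfVars {σ : Type*} {p : MvPolynomial σ ℝ} {n : ℕ}
    (hp : p.IsHomogeneous n) : p ∈ idealOfVars σ ℝ ^ n :=
  (mem_pow_idealOfVars_iff' n p).mpr fun _ hx => hp.coeff_eq_zero hx.ne

section expansion

variable {W : Type*} [Fintype W] [DecidableEq W] {δ : W → W → ℕ}

/-- Appends one factor to the expansion modulo order three: `p, x` play the role of order one and
`e, q, y` of order two, so `p * x` is the only cross term that survives. -/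
theorem second_order_mul {S M : Type*} [CommRing S] [Ring M] [Algebra S M] (A B : M)
    {p e q x y : S} (h₁ : p * y = 0) (h₂ : e * x = 0) (h₃ : e * y = 0) (h₄ : q * x = 0)
    (h₅ : q * y = 0) :
    (1 + p • A + e • A ^ 2 + q • B) * (1 + x • A + y • B) =
      1 + (p + x) • A + (e + p * x) • A ^ 2 + (q + y) • B := by
  simp only [add_mul, mul_add, smul_mul_smul_comm, h₁, h₂, h₃, h₄, h₅, zero_smul, one_mul,
    mul_one, add_zero, add_smul, pow_two]
  abel

/-- The homomorphism `φ` stands for reduction modulo terms of order three. At order two, either two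
different factors contribute `δ = 1` each, or a single factor contributes `δ = 2`. -/
theorem map_kernelProd_eq (hδ : ∀ x y, δ x y = 0 ↔ x = y) {S : Type*} [CommRing S]
    (φ : MvPolynomial ℕ ℝ →+* S) (hφ : ∀ p ∈ idealOfVars ℕ ℝ ^ 3, φ p = 0) (m : ℕ) :
    (kernelProd δ m).map φ = 1 +
      φ (∑ i ∈ Finset.range m, X i) • Matrix.of (fun x y => if δ x y = 1 then (1 : S) else 0) +
      φ (pairSum m) • Matrix.of (fun x y => if δ x y = 1 then (1 : S) else 0) ^ 2 +
      φ (∑ i ∈ Finset.range m, X i ^ 2) •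
        Matrix.of (fun x y => if δ x y = 2 then (1 : S) else 0) := by
  induction m with
  | zero => simp [kernelProd, pairSum]
  | succ m ih =>
    have hz (a b : MvPolynomial ℕ ℝ) (n : ℕ) (r : ℕ) (hn : 3 ≤ n + r)
        (ha : a ∈ idealOfVars ℕ ℝ ^ n) (hb : b ∈ idealOfVars ℕ ℝ ^ r) : φ a * φ b = 0 := by
      rw [← map_mul]
      exact hφ _ <| Ideal.pow_le_pow_right hn <|
        pow_add (idealOfVars ℕ ℝ) n r ▸ Ideal.mul_mem_mul ha hb
    have hX (d : ℕ) : (X m ^ d : MvPolynomial ℕ ℝ) ∈ idealOfVars ℕ ℝ ^ d :=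
      (isHomogeneous_X_pow m d).mem_pow_idealOfVars
    have h1 : (∑ i ∈ Finset.range m, X i : MvPolynomial ℕ ℝ) ∈ idealOfVars ℕ ℝ ^ 1 :=
      (IsHomogeneous.sum _ _ _ fun i _ => isHomogeneous_X _ i).mem_pow_idealOfVars
    have h2 : (∑ i ∈ Finset.range m, X i ^ 2 : MvPolynomial ℕ ℝ) ∈ idealOfVars ℕ ℝ ^ 2 :=
      (IsHomogeneous.sum _ _ _ fun i _ => isHomogeneous_X_pow i 2).mem_pow_idealOfVars
    have he := (isHomogeneous_pairSum m).mem_pow_idealOfVars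
    have hK : (Matrix.of fun x y => (X m : MvPolynomial ℕ ℝ) ^ δ x y).map φ =
        1 + φ (X m) • Matrix.of (fun x y => if δ x y = 1 then (1 : S) else 0) +
          φ (X m ^ 2) • Matrix.of (fun x y => if δ x y = 2 then (1 : S) else 0) := by
      ext x y
      simp only [Matrix.map_apply, Matrix.of_apply, Matrix.add_apply, Matrix.smul_apply,
        Matrix.one_apply, ← hδ, smul_eq_mul]
      match hd : δ x y with
      | 0 => simp
      | 1 => simp
      | 2 => simp
      | d + 3 =>
        simp only [Nat.reduceEqDiff, Nat.add_eq_zero_iff, if_false, OfNat.ofNat_ne_zero, and_false,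
          mul_zero, add_zero]
        exact hφ _ (Ideal.pow_le_pow_right (by omega) (hX (d + 3)))
    have hX1 : (X m : MvPolynomial ℕ ℝ) ∈ idealOfVars ℕ ℝ ^ 1 := by simpa using hX 1
    rw [kernelProd, Matrix.map_mul, ih, hK, pairSum_succ, Finset.sum_range_succ,
      Finset.sum_range_succ, map_add, map_add, map_add, map_mul φ _ (X m)]
    exact second_order_mul _ _ (hz _ _ 1 2 (by norm_num) h1 (hX 2))
      (hz _ _ 2 1 (by norm_num) he hX1) (hz _ _ 2 2 (by norm_num) he (hX 2))
      (hz _ _ 2 1 (by norm_num) h2 hX1) (hz _ _ 2 2 (by norm_num) h2 (hX 2))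

/-- The matrices of `δ = 1` and `δ = 2` have zero diagonal, so taking the trace removes the linear
term and the squares `X_i ^ 2`. -/
theorem map_trace_kernelProd (hδ : ∀ x y, δ x y = 0 ↔ x = y) {S : Type*} [CommRing S]
    (φ : MvPolynomial ℕ ℝ →+* S) (hφ : ∀ p ∈ idealOfVars ℕ ℝ ^ 3, φ p = 0) (m : ℕ) :
    φ (kernelProd δ m).trace = φ (C (Fintype.card W : ℝ) +
      C ((Matrix.of fun x y => if δ x y = 1 then (1 : ℝ) else 0) ^ 2).trace * pairSum m) := by
  have h0 (x : W) : δ x x = 0 := (hδ x x).mpr rfl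
  have hA : (Matrix.of fun x y => if δ x y = 1 then (1 : S) else 0) =
      (φ.comp C).mapMatrix (Matrix.of fun x y => if δ x y = 1 then (1 : ℝ) else 0) := by
    ext x y
    by_cases h : δ x y = 1 <;> simp [h]
  have ht (d : ℕ) (hd : d ≠ 0) :
      (Matrix.of fun x y => if δ x y = d then (1 : S) else 0).trace = 0 := by
    simp [Matrix.trace, h0, hd.symm]
  rw [AddMonoidHom.map_trace, map_kernelProd_eq hδ φ hφ, Matrix.trace_add, Matrix.trace_add,
    Matrix.trace_add, Matrix.trace_smul, Matrix.trace_smul, Matrix.trace_smul,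
    ht 1 one_ne_zero, ht 2 two_ne_zero, hA, ← map_pow, RingHom.mapMatrix_apply,
    ← AddMonoidHom.map_trace, Matrix.trace_one]
  simp [mul_comm]

theorem trace_kernelProd_sub_mem (hδ : ∀ x y, δ x y = 0 ↔ x = y) (m : ℕ) :
    (kernelProd δ m).trace - (C (Fintype.card W : ℝ) +
      C ((Matrix.of fun x y => if δ x y = 1 then (1 : ℝ) else 0) ^ 2).trace * pairSum m) ∈
      idealOfVars ℕ ℝ ^ 3 := by
  rw [← Ideal.Quotient.eq]
  exact map_trace_kernelProd hδ _ (fun _ hp => Ideal.Quotient.eq_zero_iff_mem.mpr hp) m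

end expansion

/-! ### Coefficients of large powers. -/

/-- The exponential series of `e`, truncated after the term `e ^ J / J!`. -/
noncomputable def expTrunc (e : MvPolynomial ℕ ℝ) (J : ℕ) : MvPolynomial ℕ ℝ :=
  ∑ j ∈ Finset.range (J + 1), C (1 / (j.factorial : ℝ)) * e ^ j

theorem tendsto_choose_mul_rpow (j d : ℕ) (h : 2 * j < d) :
    Tendsto (fun N : ℕ => (N : ℝ) ^ (-(d : ℝ) / 2) * (N.choose j : ℝ)) atTop (𝓝 0) := by
  have h1 : Tendsto (fun N : ℕ => (N : ℝ) ^ (-((d : ℝ) / 2 - j))) atTop (𝓝 0) := by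
    refine (tendsto_rpow_neg_atTop ?_).comp tendsto_natCast_atTop_atTop
    have : (2 * j : ℝ) < d := by exact_mod_cast h
    linarith
  refine squeeze_zero' (.of_forall fun N => by positivity) ?_ h1
  filter_upwards [eventually_gt_atTop 0] with N hN
  have hN' : (0 : ℝ) < N := by exact_mod_cast hN
  calc (N : ℝ) ^ (-(d : ℝ) / 2) * (N.choose j : ℝ) ≤ (N : ℝ) ^ (-(d : ℝ) / 2) * (N : ℝ) ^ j := by
        gcongr
        exact_mod_cast Nat.choose_le_pow N j
    _ = _ := by
        rw [← Real.rpow_natCast, ← Real.rpow_add hN']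
        congr 1
        ring

theorem tendsto_choose_mul_rpow_self (j : ℕ) :
    Tendsto (fun N : ℕ => (N : ℝ) ^ (-((2 * j : ℕ) : ℝ) / 2) * (N.choose j : ℝ)) atTop
      (𝓝 (1 / (j.factorial : ℝ))) := by
  have h1 : Asymptotics.IsEquivalent atTop
      (fun N : ℕ => (N : ℝ) ^ (-((2 * j : ℕ) : ℝ) / 2) * (N.choose j : ℝ))
      (fun N : ℕ => (N : ℝ) ^ (-((2 * j : ℕ) : ℝ) / 2) * ((N : ℝ) ^ j / (j.factorial : ℝ))) :=
    Asymptotics.IsEquivalent.refl.mul (isEquivalent_choose j)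
  refine (h1.tendsto_nhds_iff).mpr (tendsto_const_nhds.congr' ?_)
  filter_upwards [eventually_gt_atTop 0] with N hN
  have hN' : (0 : ℝ) < N := by exact_mod_cast hN
  have : -((2 * j : ℕ) : ℝ) / 2 = -(j : ℝ) := by push_cast; ring
  rw [this, Real.rpow_neg hN'.le, Real.rpow_natCast]
  field_simp

/-- Both polynomials have order at least two and agree up to order three, so their `j`-th powers
agree modulo order `2 * j + 1`. -/
theorem MvPolynomial.coeff_pow_of_sub_mem {p a : MvPolynomial ℕ ℝ} (ha : a ∈ idealOfVars ℕ ℝ ^ 2)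
    (h : p - a ∈ idealOfVars ℕ ℝ ^ 3) {s : ℕ →₀ ℕ} {j : ℕ} (hs : s.degree ≤ 2 * j) :
    (p ^ j).coeff s = (a ^ j).coeff s := by
  have hp : p ∈ idealOfVars ℕ ℝ ^ 2 := by
    have := Ideal.add_mem _ (Ideal.pow_le_pow_right (by norm_num : 2 ≤ 3) h) ha
    simpa using this
  have hmem (q : MvPolynomial ℕ ℝ) (hq : q ∈ idealOfVars ℕ ℝ ^ 2) (i : ℕ) :
      q ^ i ∈ idealOfVars ℕ ℝ ^ (2 * i) := by
    rw [pow_mul]; exact Ideal.pow_mem_pow hq i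
  have key : p ^ j - a ^ j ∈ idealOfVars ℕ ℝ ^ (2 * j + 1) := by
    induction j generalizing s with
    | zero => simp
    | succ j ih =>
      -- The claim does not involve `s`; the value `0` only discharges the degree hypothesis.
      have hj := ih (s := 0) (by simp)
      have e : p ^ (j + 1) - a ^ (j + 1) = (p ^ j - a ^ j) * p + a ^ j * (p - a) := by ring
      rw [e]
      refine Ideal.add_mem _ ?_ ?_
      · rw [show 2 * (j + 1) + 1 = (2 * j + 1) + 2 by ring, pow_add]
        exact Ideal.mul_mem_mul hj hp
      · rw [show 2 * (j + 1) + 1 = 2 * j + 3 by ring, pow_add]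
        exact Ideal.mul_mem_mul (hmem a ha j) h
  rw [mem_pow_idealOfVars_iff'] at key
  simpa [sub_eq_zero] using key s (by omega)

/-- The coefficients of `F ^ N`, suitably rescaled, converge to those of `exp (α e)` whenever
`F = 1 + α e + (terms of order at least three)` with `e` a quadratic form. -/
theorem tendsto_coeff_pow {F e : MvPolynomial ℕ ℝ} {α : ℝ} (he : e.IsHomogeneous 2)
    (hF : F - 1 - C α * e ∈ idealOfVars ℕ ℝ ^ 3) (s : ℕ →₀ ℕ) :
    Tendsto (fun N : ℕ => (N : ℝ) ^ (-(s.degree : ℝ) / 2) * (F ^ N).coeff s) atTop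
      (𝓝 (α ^ ((s.degree : ℝ) / 2) * (expTrunc e s.degree).coeff s)) := by
  have hαe : (C α * e).IsHomogeneous 2 := he.C_mul α
  have hmem := hαe.mem_pow_idealOfVars
  -- The binomial sum can be cut at `s.degree` independently of `N`: `(F - 1) ^ j` has order at
  -- least `2 * j`, and `N.choose j` vanishes for `j > N`.
  have hexp (N : ℕ) : (F ^ N).coeff s =
      ∑ j ∈ Finset.range (s.degree + 1), (N.choose j : ℝ) * ((F - 1) ^ j).coeff s := by
    have h1 : F ^ N = ∑ j ∈ Finset.range (N + 1), C (N.choose j : ℝ) * (F - 1) ^ j := by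
      conv_lhs => rw [← sub_add_cancel F 1, add_pow]
      simp [mul_comm]
    rw [h1, coeff_sum]
    simp only [coeff_C_mul]
    rcases le_total N s.degree with h | h
    · refine Finset.sum_subset (Finset.range_mono (by omega)) fun j _ hj => ?_
      rw [Finset.mem_range] at hj
      rw [Nat.choose_eq_zero_of_lt (by omega), Nat.cast_zero, zero_mul]
    · refine (Finset.sum_subset (Finset.range_mono (by omega)) fun j _ hj => ?_).symm
      rw [Finset.mem_range] at hj
      rw [coeff_pow_of_sub_mem hmem hF (by omega), (hαe.pow j).coeff_eq_zero (by omega), mul_zero]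
  simp only [hexp, expTrunc, coeff_sum, coeff_C_mul, Finset.mul_sum]
  refine tendsto_finsetSum _ fun j _ => ?_
  simp only [← mul_assoc]
  -- The scaling kills the terms with `2 * j < s.degree`, the order kills those with `2 * j >
  -- s.degree`, and equality produces the limit.
  rcases lt_trichotomy (2 * j) s.degree with h | h | h
  · rw [(he.pow j).coeff_eq_zero h.ne', mul_zero]
    simpa using (tendsto_choose_mul_rpow j _ h).mul_const (((F - 1) ^ j).coeff s)
  · rw [coeff_pow_of_sub_mem hmem hF h.ge, mul_pow, ← C_pow, coeff_C_mul, ← h]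
    have h2 : α ^ (((2 * j : ℕ) : ℝ) / 2) = α ^ j := by
      rw [← Real.rpow_natCast]; congr 1; push_cast; ring
    rw [h2, mul_comm (α ^ j) (1 / _), mul_assoc]
    exact (tendsto_choose_mul_rpow_self j).mul_const _
  · rw [coeff_pow_of_sub_mem hmem hF h.le, (he.pow j).coeff_eq_zero h.ne,
      (hαe.pow j).coeff_eq_zero h.ne]
    simp

/-! ### Gaussian integration by parts and Hermite polynomials. -/

theorem integrable_eval_gaussianReal (p : Polynomial ℝ) :
    Integrable (fun x => p.eval x) (gaussianReal 0 1) := by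
  simp only [Polynomial.eval_eq_sum_range]
  refine integrable_finsetSum _ fun i _ => Integrable.const_mul ?_ _
  refine ((memLp_id_gaussianReal (i : NNReal)).integrable_norm_pow' (p := i)).mono'
    (by fun_prop) (.of_forall fun x => by simp)

/-- Stein's identity: the derivative of the Gaussian density times `p` integrates to zero. -/
theorem integral_mul_eval_gaussianReal (p : Polynomial ℝ) :
    ∫ x, x * p.eval x ∂gaussianReal 0 1 = ∫ x, p.derivative.eval x ∂gaussianReal 0 1 := by
  have hint (q : Polynomial ℝ) : Integrable fun x => gaussianPDFReal 0 1 x * q.eval x := by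
    have h := integrable_eval_gaussianReal q
    rw [gaussianReal_of_var_ne_zero _ one_ne_zero, integrable_withDensity_iff_integrable_smul'
      (measurable_gaussianPDF _ _) (ae_of_all _ fun _ => gaussianPDF_lt_top)] at h
    simpa [toReal_gaussianPDF] using h
  have hderiv (x : ℝ) : HasDerivAt (fun x => gaussianPDFReal 0 1 x * p.eval x)
      (gaussianPDFReal 0 1 x * (p.derivative - Polynomial.X * p).eval x) x := by
    have h1 : HasDerivAt (gaussianPDFReal 0 1) (-x * gaussianPDFReal 0 1 x) x := by
      rw [gaussianPDFReal_def]
      have h2 : HasDerivAt (fun x : ℝ => -(x - 0) ^ 2 / (2 * ((1 : NNReal) : ℝ))) (-x) x := by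
        have := (((hasDerivAt_id x).sub_const 0).pow 2).neg.div_const (2 * ((1 : NNReal) : ℝ))
        refine this.congr_deriv ?_
        simp
        ring
      refine (h2.exp.const_mul _).congr_deriv ?_
      ring
    refine (h1.mul (p.hasDerivAt x)).congr_deriv ?_
    simp
    ring
  have h := integral_eq_zero_of_hasDerivAt_of_integrable hderiv (hint _) (hint _)
  have h2 : ∫ x, (p.derivative - Polynomial.X * p).eval x ∂gaussianReal 0 1 = 0 := by
    rw [integral_gaussianReal_eq_integral_smul one_ne_zero]
    exact h
  have h3 := integrable_eval_gaussianReal (Polynomial.X * p)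
  simp only [Polynomial.eval_sub] at h2
  rw [integral_sub (integrable_eval_gaussianReal _) h3] at h2
  simp only [Polynomial.eval_mul, Polynomial.eval_X] at h2
  linarith

/-- The probabilists' Hermite polynomial with real coefficients. -/
noncomputable def hermiteReal (n : ℕ) : Polynomial ℝ :=
  (Polynomial.hermite n).map (Int.castRingHom ℝ)

theorem hermiteReal_zero : hermiteReal 0 = 1 := by simp [hermiteReal]

theorem hermiteReal_succ (n : ℕ) :
    hermiteReal (n + 1) = Polynomial.X * hermiteReal n - Polynomial.derivative (hermiteReal n) := by
  simp [hermiteReal, Polynomial.hermite_succ, Polynomial.derivative_map]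

theorem derivative_hermiteReal (n : ℕ) :
    Polynomial.derivative (hermiteReal n) = (n : Polynomial ℝ) * hermiteReal (n - 1) := by
  induction n with
  | zero => simp [hermiteReal_zero]
  | succ n ih =>
    rw [hermiteReal_succ, ih]
    cases n with
    | zero => simp [hermiteReal_zero]
    | succ n =>
      simp only [Polynomial.derivative_sub, Polynomial.derivative_mul, Polynomial.derivative_X,
        Polynomial.derivative_natCast, ih, add_tsub_cancel_right]
      rw [hermiteReal_succ n]
      push_cast
      ring

theorem integral_hermiteReal_succ_mul (n : ℕ) (p : Polynomial ℝ) :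
    ∫ x, (hermiteReal (n + 1) * p).eval x ∂gaussianReal 0 1 =
      ∫ x, (hermiteReal n * p.derivative).eval x ∂gaussianReal 0 1 := by
  have h := integral_mul_eval_gaussianReal (hermiteReal n * p)
  have e1 : hermiteReal (n + 1) * p = Polynomial.X * (hermiteReal n * p) -
      Polynomial.derivative (hermiteReal n) * p := by rw [hermiteReal_succ]; ring
  have e2 (x : ℝ) : (hermiteReal (n + 1) * p).eval x = x * (hermiteReal n * p).eval x -
      (Polynomial.derivative (hermiteReal n) * p).eval x := by rw [e1]; simp
  have h4 := integrable_eval_gaussianReal (Polynomial.X * (hermiteReal n * p))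
  have h5 : Integrable (fun x => x * (hermiteReal n * p).eval x) (gaussianReal 0 1) := by
    simpa using h4
  simp only [e2]
  rw [integral_sub h5 (integrable_eval_gaussianReal _), h, Polynomial.derivative_mul]
  simp only [Polynomial.eval_add]
  rw [integral_add (integrable_eval_gaussianReal _) (integrable_eval_gaussianReal _)]
  ring

/-- The integral of the product `∏_{j < m} H_{s_j}` against the standard Gaussian. -/
noncomputable def hermiteIntegral (m : ℕ) (s : ℕ →₀ ℕ) : ℝ :=
  ∫ x, (∏ j ∈ Finset.range m, hermiteReal (s j)).eval x ∂gaussianReal 0 1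

/-- Integration by parts lowers the factor `i` and differentiates the others, where `H_n' = n
H_{n-1}`. Truncated subtraction is harmless because the factor `s l` is then zero. -/
theorem hermiteIntegral_add_single {m i : ℕ} (hi : i < m) (s : ℕ →₀ ℕ) :
    hermiteIntegral m (s + Finsupp.single i 1) =
      ∑ l ∈ (Finset.range m).erase i, (s l : ℝ) * hermiteIntegral m (s - Finsupp.single l 1) := by
  have hi' : i ∈ Finset.range m := Finset.mem_range.mpr hi
  have e1 : ∏ j ∈ Finset.range m, hermiteReal ((s + Finsupp.single i 1 : ℕ →₀ ℕ) j) =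
      hermiteReal (s i + 1) * ∏ j ∈ (Finset.range m).erase i, hermiteReal (s j) := by
    rw [← Finset.mul_prod_erase _ _ hi']
    congr 1
    · simp
    · refine Finset.prod_congr rfl fun j hj => ?_
      simp [(Finset.ne_of_mem_erase hj).symm]
  have e2 : hermiteReal (s i) * Polynomial.derivative
      (∏ j ∈ (Finset.range m).erase i, hermiteReal (s j)) =
      ∑ l ∈ (Finset.range m).erase i, Polynomial.C (s l : ℝ) *
        ∏ j ∈ Finset.range m, hermiteReal ((s - Finsupp.single l 1 : ℕ →₀ ℕ) j) := by
    rw [Polynomial.derivative_prod_finset, Finset.mul_sum]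
    refine Finset.sum_congr rfl fun l hl => ?_
    have hli := Finset.ne_of_mem_erase hl
    rw [← Finset.mul_prod_erase _ _ hi', ← Finset.mul_prod_erase _ _ hl, derivative_hermiteReal]
    have h : ∏ j ∈ ((Finset.range m).erase i).erase l,
        hermiteReal ((s - Finsupp.single l 1 : ℕ →₀ ℕ) j) =
        ∏ j ∈ ((Finset.range m).erase i).erase l, hermiteReal (s j) :=
      Finset.prod_congr rfl fun j hj => by simp [(Finset.ne_of_mem_erase hj).symm]
    rw [h]
    simp only [Finsupp.tsub_apply, Finsupp.single_eq_same, Finsupp.single_eq_of_ne hli.symm,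
      tsub_zero, map_natCast]
    ring
  rw [hermiteIntegral, e1, integral_hermiteReal_succ_mul, e2]
  simp only [Polynomial.eval_finsetSum, Polynomial.eval_C_mul]
  rw [integral_finsetSum _ fun l _ => (integrable_eval_gaussianReal _).const_mul _]
  simp only [integral_const_mul, hermiteIntegral]

/-! ### The exponential of `e₂` as generating function of Hermite integrals. -/

theorem pderiv_pairSum {m i : ℕ} (hi : i < m) :
    pderiv i (pairSum m) = ∑ l ∈ (Finset.range m).erase i, X l := by
  have hi' : i ∈ Finset.range m := Finset.mem_range.mpr hi
  have h (a : MvPolynomial ℕ ℝ) : C (1 / 2) * (2 * a) = a := by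
    rw [← map_ofNat C 2, ← mul_assoc, ← map_mul]; norm_num
  have h1 : pderiv i (∑ l ∈ Finset.range m, X l : MvPolynomial ℕ ℝ) = 1 := by
    simp [map_sum, pderiv_X, Pi.single_apply, hi]
  have h2 : pderiv i (∑ l ∈ Finset.range m, X l ^ 2 : MvPolynomial ℕ ℝ) = 2 * X i := by
    simp [map_sum, pderiv_X, Pi.single_apply, hi]
  rw [pairSum, pderiv_C_mul, map_sub, pderiv_pow, h1, h2, ← Finset.add_sum_erase _ _ hi']
  conv_rhs => rw [← h (∑ l ∈ (Finset.range m).erase i, X l)]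
  congr 1
  simp
  ring

theorem pderiv_expTrunc_succ (e : MvPolynomial ℕ ℝ) (i J : ℕ) :
    pderiv i (expTrunc e (J + 1)) = pderiv i e * expTrunc e J := by
  rw [expTrunc, Finset.sum_range_succ', map_add, map_sum, expTrunc, Finset.mul_sum]
  simp only [pow_zero, pderiv_C_mul, pderiv_one, mul_zero, add_zero]
  refine Finset.sum_congr rfl fun j _ => ?_
  have h : C (1 / ((j + 1).factorial : ℝ)) * ((j + 1 : ℕ) : MvPolynomial ℕ ℝ) =
      C (1 / (j.factorial : ℝ)) := by
    rw [← map_natCast C, ← map_mul]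
    congr 1
    rw [Nat.factorial_succ]
    push_cast
    field_simp
  rw [pderiv_pow, add_tsub_cancel_right, ← h]
  ring

theorem coeff_zero_expTrunc {e : MvPolynomial ℕ ℝ} (he : e.coeff 0 = 0) (J : ℕ) :
    (expTrunc e J).coeff 0 = 1 := by
  have h (j : ℕ) : (e ^ j).coeff 0 = 0 ^ j := by
    rw [← constantCoeff_eq, map_pow, constantCoeff_eq, he]
  simp [expTrunc, coeff_sum, coeff_C_mul, h, Finset.sum_range_succ']

theorem prod_factorial_sub_single {m l : ℕ} (hl : l < m) {s : ℕ →₀ ℕ} (hs : s l ≠ 0) :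
    ∏ j ∈ Finset.range m, ((s j).factorial : ℝ) =
      s l * ∏ j ∈ Finset.range m, (((s - Finsupp.single l 1 : ℕ →₀ ℕ) j).factorial : ℝ) := by
  have hl' : l ∈ Finset.range m := Finset.mem_range.mpr hl
  rw [← Finset.mul_prod_erase _ _ hl', ← Finset.mul_prod_erase _ _ hl', ← mul_assoc]
  congr 1
  · obtain ⟨n, hn⟩ := Nat.exists_eq_succ_of_ne_zero hs
    simp [hn, Nat.factorial_succ]
  · refine Finset.prod_congr rfl fun j hj => ?_
    simp [(Finset.ne_of_mem_erase hj).symm]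

/-- Induction on the truncation level: the integrals obey `hermiteIntegral_add_single`, and the
coefficients obey the matching recursion coming from `∂_i exp e₂ = (∑_{l ≠ i} X_l) exp e₂`. The
factorials absorb the weights `s l`. -/
theorem hermiteIntegral_eq {m J : ℕ} {s : ℕ →₀ ℕ} (hs : ∀ j, m ≤ j → s j = 0)
    (hJ : s.degree ≤ J) : hermiteIntegral m s =
      (∏ j ∈ Finset.range m, ((s j).factorial : ℝ)) * (expTrunc (pairSum m) J).coeff s := by
  have h0 : (pairSum m).coeff 0 = 0 := (isHomogeneous_pairSum m).coeff_eq_zero (by simp)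
  induction J generalizing s with
  | zero =>
    obtain rfl : s = 0 := (Finsupp.degree_eq_zero_iff s).mp (by omega)
    simp [coeff_zero_expTrunc h0, hermiteIntegral, hermiteReal_zero]
  | succ J ih =>
    rcases eq_or_ne s 0 with rfl | hne
    · simp [coeff_zero_expTrunc h0, hermiteIntegral, hermiteReal_zero]
    obtain ⟨i, hi⟩ := Finsupp.ne_iff.mp hne
    rw [Finsupp.zero_apply] at hi
    have him : i < m := by
      by_contra h
      exact hi (hs i (by omega))
    obtain ⟨t, rfl⟩ : ∃ t, s = t + Finsupp.single i 1 :=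
      ⟨s - Finsupp.single i 1, (tsub_add_cancel_of_le
        (Finsupp.single_le_iff.mpr (Nat.one_le_iff_ne_zero.mpr hi))).symm⟩
    have ht (j : ℕ) (hj : m ≤ j) : t j = 0 := by
      have := hs j hj
      rw [Finsupp.add_apply] at this
      omega
    have hdeg : t.degree ≤ J := by simpa using hJ
    -- Differentiating in `X_i` turns the coefficient at `t + single i 1` into `t i + 1` times
    -- itself, at exponent `t`.
    have hc := coeff_pderiv (i := i) (expTrunc (pairSum m) (J + 1)) t
    rw [pderiv_expTrunc_succ, pderiv_pairSum him, Finset.sum_mul, coeff_sum] at hc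
    rw [hermiteIntegral_add_single him, prod_factorial_sub_single him hi, add_tsub_cancel_right]
    have e : ((t + Finsupp.single i 1 : ℕ →₀ ℕ) i : ℝ) = t i + 1 := by simp
    rw [e, mul_comm (_ + _), mul_assoc, mul_comm (_ + _), ← hc, Finset.mul_sum]
    refine Finset.sum_congr rfl fun l hl => ?_
    rw [coeff_X_mul']
    have hlm := Finset.mem_range.mp (Finset.mem_of_mem_erase hl)
    split_ifs with h
    · rw [Finsupp.mem_support_iff] at h
      rw [prod_factorial_sub_single hlm h, mul_assoc]
      congr 1
      refine ih (fun j hj => by rw [Finsupp.tsub_apply, ht j hj, zero_tsub]) ?_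
      exact (Finsupp.degree_mono tsub_le_self).trans hdeg
    · rw [Finsupp.notMem_support_iff.mp h]
      simp

theorem integral_hermiteReal_pow (k m : ℕ) :
    ∫ x, (hermiteReal k).eval x ^ m ∂gaussianReal 0 1 =
      (k.factorial : ℝ) ^ m * (expTrunc (pairSum m) (m * k)).coeff (constExponent k m) := by
  have h := hermiteIntegral_eq (m := m) (J := m * k) (s := constExponent k m)
    (fun j hj => by rw [constExponent_apply, if_neg (by omega)]) (degree_constExponent k m).le
  have e : ∏ j ∈ Finset.range m, hermiteReal (constExponent k m j) = hermiteReal k ^ m := by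
    rw [Finset.prod_congr rfl (g := fun _ => hermiteReal k) fun j hj => by
      rw [constExponent_apply, if_pos (Finset.mem_range.mp hj)]]
    simp
  have e' : ∏ j ∈ Finset.range m, ((constExponent k m j).factorial : ℝ) =
      (k.factorial : ℝ) ^ m := by
    rw [Finset.prod_congr rfl (g := fun _ => (k.factorial : ℝ)) fun j hj => by
      rw [constExponent_apply, if_pos (Finset.mem_range.mp hj)]]
    simp
  rw [hermiteIntegral, e, e'] at h
  simpa using h

/-! ### Assembly: convergence of the moments. -/

theorem tendsto_moment {W : Type*} [Fintype W] [DecidableEq W] [Nonempty W] {δ : W → W → ℕ}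
    (hδ : ∀ x y, δ x y = 0 ↔ x = y) {α : ℝ}
    (hα : ((Matrix.of fun x y => if δ x y = 1 then (1 : ℝ) else 0) ^ 2).trace =
      Fintype.card W * α) (k m : ℕ) :
    Tendsto (fun N : ℕ => (N : ℝ) ^ (-((m * k : ℕ) : ℝ) / 2) *
      ((Fintype.card (Fin N → W) : ℝ)⁻¹ * ((Matrix.of fun x y : Fin N → W =>
        if ∑ i, δ (x i) (y i) = k then (1 : ℝ) else 0) ^ m).trace)) atTop
      (𝓝 (α ^ (((m * k : ℕ) : ℝ) / 2) *
        (expTrunc (pairSum m) (m * k)).coeff (constExponent k m))) := by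
  have hn : (Fintype.card W : ℝ) ≠ 0 := by simp
  set F : MvPolynomial ℕ ℝ := C (Fintype.card W : ℝ)⁻¹ * (kernelProd δ m).trace with hF
  have hmem : F - 1 - C α * pairSum m ∈ idealOfVars ℕ ℝ ^ 3 := by
    have h := Ideal.mul_mem_left _ (C (Fintype.card W : ℝ)⁻¹) (trace_kernelProd_sub_mem hδ m)
    rw [hα, C_mul] at h
    have e : (C (Fintype.card W : ℝ)⁻¹ * C (Fintype.card W : ℝ) : MvPolynomial ℕ ℝ) = 1 := by
      rw [← C_mul, inv_mul_cancel₀ hn, C_1]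
    convert h using 1
    rw [hF]
    linear_combination (1 + C α * pairSum m) * e
  have h := tendsto_coeff_pow (isHomogeneous_pairSum m) hmem (constExponent k m)
  rw [degree_constExponent] at h
  refine h.congr fun N => ?_
  rw [trace_pow_eq_coeff, hF, mul_pow, ← C_pow, coeff_C_mul]
  simp

theorem SimpleGraph.trace_dist_one_sq {V : Type*} [Fintype V] [DecidableEq V] (G : SimpleGraph V)
    [DecidableRel G.Adj] :
    ((Matrix.of fun x y => if G.dist x y = 1 then (1 : ℝ) else 0) ^ 2).trace =
      2 * (G.edgeFinset.card : ℝ) := by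
  have h : (Matrix.of fun x y => if G.dist x y = 1 then (1 : ℝ) else 0) = G.adjMatrix ℝ := by
    ext x y
    simp [SimpleGraph.adjMatrix_apply, SimpleGraph.dist_eq_one_iff_adj]
  rw [h, pow_two, Matrix.trace]
  simp only [Matrix.diag, SimpleGraph.adjMatrix_mul_self_apply_self]
  exact_mod_cast G.sum_degrees_eq_twice_card_edges

theorem theorem1p1 {V : Type*} [Fintype V] [DecidableEq V] (G : SimpleGraph V)
    [DecidableRel G.Adj] (hG : G.Connected) (hV : 2 ≤ Fintype.card V) (k : ℕ) (hk : 1 ≤ k)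
    {Ω : Type*} [MeasurableSpace Ω] (P : Measure Ω) [IsProbabilityMeasure P]
    (g : Ω → ℝ) (hg : HasLaw g (gaussianReal 0 1) P) :
    ConvergesInMoments
      (fun N => (G.isHermitian_smul_powerDistanceMatrix N k
        ((N : ℝ) ^ (-(k : ℝ) / 2))).eigenvalueDistribution)
      (P.map fun ω =>
        (2 * (G.edgeFinset.card : ℝ) / (Fintype.card V : ℝ)) ^ ((k : ℝ) / 2) *
          (1 / (k.factorial : ℝ)) * Polynomial.aeval (g ω) (Polynomial.hermite k)) := by
  have hne : Nonempty V := hG.nonempty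
  set α : ℝ := 2 * (G.edgeFinset.card : ℝ) / (Fintype.card V : ℝ) with hα
  have hα0 : 0 ≤ α := by positivity
  set c : ℝ := α ^ ((k : ℝ) / 2) * (1 / (k.factorial : ℝ)) with hc
  have hmap : (P.map fun ω => c * Polynomial.aeval (g ω) (Polynomial.hermite k)) =
      (gaussianReal 0 1).map fun x => c * (hermiteReal k).eval x := by
    rw [← hg.map_eq, AEMeasurable.map_map_of_aemeasurable (by fun_prop) hg.aemeasurable]
    congr 1
    ext ω
    simp [hermiteReal, Polynomial.aeval_def, Polynomial.eval_map]
  rw [hmap]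
  refine ⟨fun N m => Matrix.IsHermitian.integrable_eigenvalueDistribution _ _, fun m => ?_,
    fun m => ?_⟩
  · rw [integrable_map_measure (by fun_prop) (by fun_prop)]
    convert integrable_eval_gaussianReal ((Polynomial.C c * hermiteReal k) ^ m) using 2
    simp
  · have hlim : ∫ x, x ^ m ∂((gaussianReal 0 1).map fun x => c * (hermiteReal k).eval x) =
        α ^ (((m * k : ℕ) : ℝ) / 2) *
          (expTrunc (pairSum m) (m * k)).coeff (constExponent k m) := by
      rw [integral_map (by fun_prop) (by fun_prop)]
      simp only [mul_pow]
      rw [integral_const_mul, integral_hermiteReal_pow, hc, mul_pow, ← Real.rpow_mul_natCast hα0]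
      have hk0 : (k.factorial : ℝ) ≠ 0 := by positivity
      rw [show (k : ℝ) / 2 * m = ((m * k : ℕ) : ℝ) / 2 by push_cast; ring,
        one_div, inv_pow]
      field_simp
    rw [hlim]
    -- The value of `α` is forced by the trace of the squared adjacency matrix, `2|E| = |V| α`.
    refine (tendsto_moment (δ := fun x y => G.dist x y) (fun x y => hG.dist_eq_zero_iff) ?_
      k m).congr fun N => ?_
    · rw [G.trace_dist_one_sq, hα]
      field_simp
    · rw [Matrix.IsHermitian.integral_pow_eigenvalueDistribution, hG.powerDistanceMatrix_eq hk,
        smul_pow, Matrix.trace_smul, ← Real.rpow_mul_natCast (Nat.cast_nonneg N), smul_eq_mul]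
      rw [show -(k : ℝ) / 2 * m = -((m * k : ℕ) : ℝ) / 2 by push_cast; ring]
      ring
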